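/- Let $\mathbb{K}$ be a field of characteristic zero, let $1\le n\le m$, and let $\mathbb{K}(t,\mathbf{x})$ be the field of rational functions in $t$ and $\mathbf{x}=(x_1,\dots,x_m)$. For each variable $v\in\{t,x_1,\dots,x_m\}$ let $\sigma_v$ be the $\mathbb{K}$-automorphism of $\mathbb{K}(t,\mathbf{x})$ that maps $v$ to $v+1$ and fixes the other variables. Put $G=\langle\sigma_{x_1},\dots,\sigma_{x_n}\rangle$ and $G_t=\langle\sigma_t,\sigma_{x_1},\dots,\sigma_{x_n}\rangle$, and for a polynomial $d$ let $G_d=\{\sigma\in G:\sigma(d)=d\}$ and $G_{t,d}=\{\sigma\in G_t:\sigma(d)=d\}$. Polynomials $p,q$ are called $G$-equivalent if $\{\sigma(p):\sigma\in G\}=\{\sigma(q):\sigma\in G\}$. Let $\mathbb{K}(t)\langle S_t\rangle$ be the ring of operators $L=\sum_i e_iS_t^i$ (finite sums over $i\ge 0$) with $e_i\in\mathbb{K}(t)$ and $S_te=\sigma_t(e)S_t$ for $e\in\mathbb{K}(t)$, acting by $L(h)=\sum_i e_i\sigma_t^i(h)$. A telescoper of type $(\sigma_t;\sigma_{x_1},\dots,\sigma_{x_n})$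 for $h\in\mathbb{K}(t,\mathbf{x})$ is a nonzero $L\in\mathbb{K}(t)\langle S_t\rangle$ such that $L(h)=\sum_{k=1}^n(\sigma_{x_k}(g_k)-g_k)$ for some $g_1,\dots,g_n\in\mathbb{K}(t,\mathbf{x})$. Let $$f=\sum_{i=0}^{I}\frac{a_i}{\sigma_t^i(d)^j},$$ where $I\ge 0$ and $j\ge 1$ are integers, $d\in\mathbb{K}[t,\mathbf{x}]$ is irreducible, $a_i\in\mathbb{K}(t,x_2,\dots,x_m)[x_1]$ with $\deg_{x_1}(a_i)<\deg_{x_1}(d)$ for $0\le i\le I$ (with $\deg_{x_1}(0)=-\infty$), and $\sigma_t^i(d)$, $\sigma_t^{i'}(d)$ are not $G$-equivalent for $0\le i\ne i'\le I$. If $\operatorname{rank}(G_{t,d}/G_d)=1$, then $f$ has a telescoper of type $(\sigma_t;\sigma_{x_1},\dots,\sigma_{x_n})$ if and only if, for every $0\le i\le I$, the fraction $a_i/\sigma_t^i(d)^j$ has a telescoper of the same type. -/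

import Mathlib

noncomputable section

/-- The indices of the variables: `none` is `t` and `some i` is `x_{i+1}` for `i = 0, …, m - 1`. -/
abbrev ShiftVar (m : ℕ) := Option (Fin m)

/-- The polynomial ring `K[t, x_1, …, x_m]`. -/
abbrev PolyTX (K : Type*) [Field K] (m : ℕ) := MvPolynomial (ShiftVar m) K

/-- The field of rational functions `K(t, x_1, …, x_m)`. -/
abbrev RatTX (K : Type*) [Field K] (m : ℕ) := FractionRing (PolyTX K m)

/-- The variable with index `v`, as a rational function. -/
def varTX (K : Type*) [Field K] {m : ℕ} (v : ShiftVar m) : RatTX K m :=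
  algebraMap (PolyTX K m) (RatTX K m) (MvPolynomial.X v)

/-- The substitution `v ↦ v + c` on polynomials that fixes the other variables. -/
def polyTranslate (K : Type*) [Field K] {m : ℕ} (v : ShiftVar m) (c : K) :
    PolyTX K m →ₐ[K] PolyTX K m :=
  MvPolynomial.aeval fun w =>
    if w = v then MvPolynomial.X w + MvPolynomial.C c else MvPolynomial.X w

theorem polyTranslate_X (K : Type*) [Field K] {m : ℕ} (v w : ShiftVar m) (c : K) :
    polyTranslate K v c (MvPolynomial.X w) =
      if w = v then MvPolynomial.X w + MvPolynomial.C c else MvPolynomial.X w := by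
  simp [polyTranslate]

theorem polyTranslate_comp (K : Type*) [Field K] {m : ℕ} (v : ShiftVar m) (c c' : K)
    (h : c + c' = 0) :
    (polyTranslate K v c).comp (polyTranslate K v c') = AlgHom.id K (PolyTX K m) := by
  ext1 w
  have hC : (MvPolynomial.C c : PolyTX K m) + MvPolynomial.C c' = 0 := by
    rw [← MvPolynomial.C_add, h, MvPolynomial.C_0]
  have h2 : polyTranslate K v c (MvPolynomial.C c') = MvPolynomial.C c' :=
    (polyTranslate K v c).commutes c'
  by_cases hw : w = v
  · simp [polyTranslate_X, hw, h2, add_assoc, hC]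
  · simp [polyTranslate_X, hw]

/-- The shift `v ↦ v + 1` as an automorphism of the polynomial ring. -/
def polyShift (K : Type*) [Field K] {m : ℕ} (v : ShiftVar m) : PolyTX K m ≃ₐ[K] PolyTX K m :=
  AlgEquiv.ofAlgHom (polyTranslate K v 1) (polyTranslate K v (-1))
    (polyTranslate_comp K v 1 (-1) (by ring)) (polyTranslate_comp K v (-1) 1 (by ring))

/-- The shift operator `σ_v`: the `K`-automorphism of `K(t, x_1, …, x_m)` with `σ_v(v) = v + 1`
that fixes all the other variables. -/
def shiftTX (K : Type*) [Field K] {m : ℕ} (v : ShiftVar m) : RatTX K m ≃ₐ[K] RatTX K m :=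
  IsFractionRing.fieldEquivOfAlgEquiv K (RatTX K m) (RatTX K m) (polyShift K v)

theorem shiftTX_algebraMap (K : Type*) [Field K] {m : ℕ} (v : ShiftVar m) (p : PolyTX K m) :
    shiftTX K v (algebraMap (PolyTX K m) (RatTX K m) p) =
      algebraMap (PolyTX K m) (RatTX K m) (polyShift K v p) := by
  simp [shiftTX]

theorem shiftTX_var_self (K : Type*) [Field K] {m : ℕ} (v : ShiftVar m) :
    shiftTX K v (varTX K v) = varTX K v + 1 := by
  simp [varTX, shiftTX_algebraMap, polyShift, polyTranslate_X]

theorem shiftTX_var_of_ne (K : Type*) [Field K] {m : ℕ} (v w : ShiftVar m) (h : w ≠ v) :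
    shiftTX K v (varTX K w) = varTX K w := by
  simp [varTX, shiftTX_algebraMap, polyShift, polyTranslate_X, h]

theorem polyShift_comm (K : Type*) [Field K] {m : ℕ} (v w : ShiftVar m) (p : PolyTX K m) :
    polyShift K v (polyShift K w p) = polyShift K w (polyShift K v p) := by
  have h : (polyTranslate K v 1).comp (polyTranslate K w 1) =
      (polyTranslate K w 1).comp (polyTranslate K v 1) := by
    ext1 u
    by_cases hv : u = v <;> by_cases hw : u = w <;> simp [polyTranslate_X, hv, hw]
    all_goals simp_all [polyTranslate_X]
  exact DFunLike.congr_fun h p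

theorem shiftTX_comm (K : Type*) [Field K] {m : ℕ} (v w : ShiftVar m) :
    shiftTX K v * shiftTX K w = shiftTX K w * shiftTX K v := by
  ext f
  obtain ⟨p, q, -, rfl⟩ := IsFractionRing.div_surjective (A := PolyTX K m) f
  simp [AlgEquiv.mul_apply, map_div₀, shiftTX_algebraMap, polyShift_comm K v w]

/-- The group `G = ⟨σ_{x_1}, …, σ_{x_n}⟩` of automorphisms of `K(t, x_1, …, x_m)`. -/
def groupX (K : Type*) [Field K] {m n : ℕ} (hnm : n ≤ m) : Subgroup (RatTX K m ≃ₐ[K] RatTX K m) :=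
  Subgroup.closure (Set.range fun i : Fin n => shiftTX K (some (Fin.castLE hnm i)))

/-- The group `G_t = ⟨σ_t, σ_{x_1}, …, σ_{x_n}⟩` of automorphisms of `K(t, x_1, …, x_m)`. -/
def groupTX (K : Type*) [Field K] {m n : ℕ} (hnm : n ≤ m) :
    Subgroup (RatTX K m ≃ₐ[K] RatTX K m) :=
  Subgroup.closure
    (insert (shiftTX K none) (Set.range fun i : Fin n => shiftTX K (some (Fin.castLE hnm i))))

/-- The isotropy group `A_p = {σ ∈ A ∣ σ(p) = p}`. -/
def isotropy {K : Type*} [Field K] {m : ℕ} (A : Subgroup (RatTX K m ≃ₐ[K] RatTX K m))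
    (p : RatTX K m) : Subgroup (RatTX K m ≃ₐ[K] RatTX K m) :=
  A ⊓ MulAction.stabilizer (RatTX K m ≃ₐ[K] RatTX K m) p

/-- The orbit `[p]_A = {σ(p) ∣ σ ∈ A}`. -/
def shiftOrbit {K : Type*} [Field K] {m : ℕ} (A : Subgroup (RatTX K m ≃ₐ[K] RatTX K m))
    (p : RatTX K m) : Set (RatTX K m) :=
  {q | ∃ σ ∈ A, q = σ p}

/-- `p` and `q` are `A`-equivalent: `[p]_A = [q]_A`. -/
def ShiftEquivalent {K : Type*} [Field K] {m : ℕ} (A : Subgroup (RatTX K m ≃ₐ[K] RatTX K m))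
    (p q : RatTX K m) : Prop :=
  shiftOrbit A p = shiftOrbit A q

instance isMulCommutative_groupTX (K : Type*) [Field K] {m n : ℕ} (hnm : n ≤ m) :
    IsMulCommutative (groupTX K hnm) := by
  apply Subgroup.isMulCommutative_closure
  rintro _ (rfl | ⟨i, rfl⟩) _ (rfl | ⟨j, rfl⟩) <;> exact shiftTX_comm K _ _

instance isMulCommutative_isotropy {K : Type*} [Field K] {m : ℕ}
    (A : Subgroup (RatTX K m ≃ₐ[K] RatTX K m)) [IsMulCommutative A] (p : RatTX K m) :
    IsMulCommutative (isotropy A p) :=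
  IsMulCommutative.of_setLike_mul_comm fun _ ha _ hb =>
    setLike_mul_comm ha.1 hb.1

open scoped IsMulCommutative in
/-- The rank of the abelian group `A / B` for subgroups `B ≤ A` with `A` commutative, that is, its
rank as a `ℤ`-module. -/
def quotientRank {Γ : Type*} [Group Γ] (A B : Subgroup Γ) [IsMulCommutative A] : ℕ :=
  Module.finrank ℤ (Additive (A ⧸ B.subgroupOf A))

/-- The rank of `G_{t,p} / G_p`. -/
def isotropyRank {K : Type*} [Field K] {m n : ℕ} (hnm : n ≤ m) (p : RatTX K m) : ℕ :=
  quotientRank (isotropy (groupTX K hnm) p) (isotropy (groupX K hnm) p)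

/-- The field `K(t)`, as a subfield of `K(t, x_1, …, x_m)`. -/
abbrev FieldT (K : Type*) [Field K] (m : ℕ) : IntermediateField K (RatTX K m) :=
  IntermediateField.adjoin K {varTX K none}

theorem shiftTX_mem_fieldT (K : Type*) [Field K] {m : ℕ} (f : FieldT K m) :
    shiftTX K none (f : RatTX K m) ∈ FieldT K m := by
  have h : FieldT K m ≤ (FieldT K m).comap (shiftTX K (none : ShiftVar m)).toAlgHom := by
    rw [IntermediateField.adjoin_le_iff, Set.singleton_subset_iff]
    change shiftTX K none (varTX K none) ∈ FieldT K m
    rw [shiftTX_var_self]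
    exact add_mem (IntermediateField.mem_adjoin_simple_self K _) (one_mem _)
  exact h f.2

/-- The restriction of `σ_t` to `K(t)`. -/
def shiftT (K : Type*) [Field K] (m : ℕ) : FieldT K m →+* FieldT K m :=
  ((shiftTX K (none : ShiftVar m) : RatTX K m →+* RatTX K m).comp
    (FieldT K m).val.toRingHom).codRestrict (FieldT K m) (shiftTX_mem_fieldT K)

/-- The powers of `σ_t` act on `K(t)`; this fixes the commutation rule `S_t f = σ_t(f) S_t` in
the ring of operators `K(t)⟨S_t⟩`. -/
instance shiftTAction (K : Type*) [Field K] (m : ℕ) :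
    MulSemiringAction (Multiplicative ℕ) (FieldT K m) :=
  MulSemiringAction.compHom (FieldT K m) (powersHom (FieldT K m →+* FieldT K m) (shiftT K m))

/-- The ring `K(t)⟨S_t⟩` of linear recurrence operators. -/
abbrev RecOp (K : Type*) [Field K] (m : ℕ) := SkewPolynomial (FieldT K m)

/-- The action `L(f) = ∑ e_i σ_t^i(f)` of the operator `L = ∑ e_i S_t^i`. -/
def RecOp.apply {K : Type*} [Field K] {m : ℕ} (L : RecOp K m) (f : RatTX K m) : RatTX K m :=
  SkewPolynomial.sum L fun i e => (e : RatTX K m) * (shiftTX K none ^ i) f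

/-- `f` is `(σ_{x_1}, …, σ_{x_n})`-summable in `K(t, x_1, …, x_m)`. -/
def IsSummableX {K : Type*} [Field K] {m n : ℕ} (hnm : n ≤ m) (f : RatTX K m) : Prop :=
  ∃ g : Fin n → RatTX K m, f = ∑ i, (shiftTX K (some (Fin.castLE hnm i)) (g i) - g i)

/-- `L` is a telescoper of type `(σ_t; σ_{x_1}, …, σ_{x_n})` for `f`. -/
def IsTelescoper {K : Type*} [Field K] {m n : ℕ} (hnm : n ≤ m) (L : RecOp K m)
    (f : RatTX K m) : Prop :=
  L ≠ 0 ∧ IsSummableX hnm (L.apply f)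

/-- `f` has a telescoper of type `(σ_t; σ_{x_1}, …, σ_{x_n})`. -/
def HasTelescoper {K : Type*} [Field K] {m n : ℕ} (hnm : n ≤ m) (f : RatTX K m) : Prop :=
  ∃ L : RecOp K m, IsTelescoper hnm L f

/-- The field `K(t, x_2, …, x_m)`, as a subfield of `K(t, x_1, …, x_m)`. -/
abbrev FieldHatX (K : Type*) [Field K] (m : ℕ) [NeZero m] : IntermediateField K (RatTX K m) :=
  IntermediateField.adjoin K (varTX K '' {v : ShiftVar m | v ≠ some 0})

/-- `a ∈ K(t, x_2, …, x_m)[x_1]` with `deg_{x_1}(a) < deg_{x_1}(d)`; the zero polynomial has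
degree `-∞`. -/
def IsPolyX1DegLT {K : Type*} [Field K] {m : ℕ} [NeZero m] (a : RatTX K m) (d : PolyTX K m) :
    Prop :=
  ∃ p : Polynomial (FieldHatX K m),
    Polynomial.aeval (varTX K (some 0)) p = a ∧ p.degree < (MvPolynomial.degreeOf (some 0) d : ℕ)

end

/-!
Write `D` for the polynomials free of `x_1` and `[p]` for the orbit of a polynomial `p` under `G`.

The substance is the passage from `f` to its summands. It rests on partial fractions with respect
to `x_1`. Fix the orbit `P = [σ_t^{i₀}(d)]`. By Gauss's lemma an irreducible `p` and a `q` not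
divisible by it generate an ideal that contains a nonzero element of `D`
(`MvPolynomial.exists_bezout_supported`). Hence every rational function is a sum of one whose
denominator is, up to a factor in `D`, a product of elements of `P`, and one whose denominator is
divisible by no element of `P`, up to a factor in `D` again (`exists_add_of_poles`). A function of both kinds is a polynomial in
`x_1` with coefficients in `K(t, x_2, …, x_m)` (`mem_fracs_freeOf_of_poles`), and those are summable
in `x_1` because Bernoulli polynomials are antidifferences of powers
(`fracs_freeOf_le_summableX`). Both kinds are stable under `G`, so if a sum of a function of the first
kind and one of the second kind is summable, then so is the first summand
(`mem_summableX_of_add_mem`).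

To apply this, the terms of `L(f)` must be sorted by `i`. The rank condition gives `k > 0` and
`τ ∈ G` with `σ_t^k(d) = τ(d)` (`exists_shift_pow_eq_of_isotropyRank_ne_zero`), so an operator `L` in
powers of `S_t^k` maps the `i`-th fraction of `f` to one whose poles lie in `[σ_t^i(d)]`. If `f` has
a telescoper, it has one of this form: modulo the summable functions, the `σ_t^l(f)` span a
finite-dimensional `K(t)`-space (`HasTelescoper.shiftFinite`), in which the `σ_t^{kl}(f)` are linearly
dependent. Orbits that differ share no prime even up to constant factors, since a translation that
maps a polynomial to a multiple of itself fixes it (`MvPolynomial.eq_one_of_translate_eq_C_mul`).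

The converse also follows from the characterization by finite dimension, which is plainly inherited
by sums (`shiftFinite_sum`).
-/

noncomputable section

/-! ### Bézout relations and translations of polynomials -/

/-- Over the fraction field of `D` the polynomials are coprime by Gauss's lemma; clearing
denominators in a Bézout relation leaves a nonzero constant. -/
theorem Polynomial.exists_bezout_C_of_irreducible {D : Type*} [CommRing D] [IsDomain D]
    [UniqueFactorizationMonoid D] {p q : Polynomial D} (hp : Irreducible p) (hpq : ¬ p ∣ q) :
    ∃ α β : Polynomial D, ∃ r : D, r ≠ 0 ∧ α * p + β * q = Polynomial.C r := by
  classical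
  by_cases hdeg : p.natDegree = 0
  · obtain ⟨c, rfl⟩ := Polynomial.natDegree_eq_zero.mp hdeg
    exact ⟨1, 0, c, fun h => hp.ne_zero (by simp [h]), by simp⟩
  · let _ : NormalizedGCDMonoid D := Nonempty.some inferInstance
    have hprim := hp.isPrimitive hdeg
    have hirr := (hprim.irreducible_iff_irreducible_map_fraction_map (K := FractionRing D)).mp hp
    have hndvd : ¬ p.map (algebraMap D (FractionRing D)) ∣ q.map (algebraMap D (FractionRing D)) :=
      fun h => hpq (hprim.dvd_of_fraction_map_dvd_fraction_map h)
    obtain ⟨a, b, hab⟩ := (hirr.coprime_iff_not_dvd).mpr hndvd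
    obtain ⟨s, hsm, hs⟩ := IsLocalization.integerNormalization_spec (nonZeroDivisors D) a
    obtain ⟨s', hsm', hs'⟩ := IsLocalization.integerNormalization_spec (nonZeroDivisors D) b
    refine ⟨Polynomial.C s' * IsLocalization.integerNormalization (nonZeroDivisors D) a,
      Polynomial.C s * IsLocalization.integerNormalization (nonZeroDivisors D) b,
      s * s', mul_ne_zero (nonZeroDivisors.ne_zero hsm) (nonZeroDivisors.ne_zero hsm'), ?_⟩
    apply Polynomial.map_injective _ (IsFractionRing.injective D (FractionRing D))
    simp only [Polynomial.map_add, Polynomial.map_mul, Polynomial.map_C, map_mul, hs, hs',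
      Algebra.smul_def, Polynomial.algebraMap_apply] at *
    linear_combination (Polynomial.C (algebraMap D (FractionRing D) s) *
      Polynomial.C (algebraMap D (FractionRing D) s')) * hab

theorem MvPolynomial.exists_bezout_supported {K σ : Type*} [Field K] (v : σ)
    {p q : MvPolynomial σ K} (hp : Irreducible p) (hpq : ¬ p ∣ q) :
    ∃ α β : MvPolynomial σ K, ∃ r ∈ MvPolynomial.supported K {w | w ≠ v},
      r ≠ 0 ∧ α * p + β * q = r := by
  classical
  let φ : MvPolynomial σ K ≃ₐ[K] Polynomial (MvPolynomial {w // w ≠ v} K) :=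
    (renameEquiv K (Equiv.optionSubtypeNe v).symm).trans (optionEquivLeft K _)
  have hφ : ∀ r, φ (rename Subtype.val r) = Polynomial.C r := by
    intro r
    induction r using MvPolynomial.induction_on with
    | C a => simp [φ]
    | add p q hp hq => simp only [map_add, hp, hq]
    | mul_X p i hp =>
      have : (Equiv.optionSubtypeNe v).symm i.1 = some i := by simp [i.2]
      simp only [map_mul, hp, rename_X]
      simp [φ, this]
  obtain ⟨α, β, r, hr, h⟩ := Polynomial.exists_bezout_C_of_irreducible
    (p := φ p) (q := φ q) ((MulEquiv.irreducible_iff φ).mpr hp)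
    (fun h => hpq ((map_dvd_iff φ).mp h))
  refine ⟨φ.symm α, φ.symm β, rename Subtype.val r, ?_, ?_, ?_⟩
  · rw [supported_eq_range_rename]; exact ⟨r, rfl⟩
  · exact fun h0 => hr (rename_injective _ Subtype.val_injective (by simpa using h0))
  · apply φ.injective
    simp [hφ, h]

/-- A translation cannot rescale a nonzero polynomial `p` by a constant `c ≠ 1`: along the line
`X + s v` with a new variable `s`, the translation becomes `s ↦ s + 1`, which keeps the leading
coefficient in `s`. -/
theorem MvPolynomial.eq_one_of_translate_eq_C_mul {K σ : Type*} [Field K]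
    (φ : MvPolynomial σ K →ₐ[K] MvPolynomial σ K) (v : σ → K)
    (hφ : ∀ w, φ (X w) = X w + C (v w)) {p : MvPolynomial σ K} (hp : p ≠ 0) {c : K}
    (h : φ p = C c * p) : c = 1 := by
  let θ : MvPolynomial σ K →ₐ[K] Polynomial (MvPolynomial σ K) :=
    aeval fun w => Polynomial.C (X w) + Polynomial.C (C (v w)) * Polynomial.X
  have h0 : ∀ q, Polynomial.eval 0 (θ q) = q := by
    intro q
    induction q using MvPolynomial.induction_on with
    | C a => simp [θ, Polynomial.algebraMap_apply]
    | add p q hp hq => simp [hp, hq]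
    | mul_X p i hp => simp [hp]; simp [θ]
  have h1 : ∀ q, Polynomial.taylor 1 (θ q) = θ (φ q) := by
    intro q
    induction q using MvPolynomial.induction_on with
    | C a =>
      have : φ (C a) = C a := φ.commutes a
      simp [θ, Polynomial.algebraMap_apply, this]
    | add p q hp hq => simp [hp, hq]
    | mul_X p i hp =>
      simp only [map_mul, Polynomial.taylor_mul, hp, hφ, map_add]
      simp [θ, Polynomial.algebraMap_apply]
      left
      ring
  have hθ : θ p ≠ 0 := fun h' => hp (by rw [← h0 p, h', Polynomial.eval_zero])
  have h2 := congrArg Polynomial.leadingCoeff (h1 p)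
  have h3 : θ (C c) = Polynomial.C (C c) := by simp [θ, Polynomial.algebraMap_apply]
  rw [Polynomial.leadingCoeff_taylor, h, map_mul, h3, Polynomial.leadingCoeff_mul,
    Polynomial.leadingCoeff_C] at h2
  have h4 : (C c : MvPolynomial σ K) = C 1 := by
    apply mul_right_cancel₀ (Polynomial.leadingCoeff_ne_zero.mpr hθ)
    rw [← h2, C_1, one_mul]
  exact C_injective _ _ h4

/-! ### Localizations stable under the shifts -/

section Fracs

variable {K : Type*} [Field K] {m : ℕ}

/-- The rational functions whose denominator can be taken in the multiplicative set `S`, that is,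
the localization of `K[t, x_1, …, x_m]` at `S` as a subring of `K(t, x_1, …, x_m)`. The
condition is vacuous if `0 ∈ S`. -/
def fracs (S : Submonoid (PolyTX K m)) : Subring (RatTX K m) where
  carrier := {h | ∃ s ∈ S, ∃ p : PolyTX K m,
    algebraMap _ (RatTX K m) s * h = algebraMap _ (RatTX K m) p}
  mul_mem' := by
    rintro a b ⟨s, hs, p, hp⟩ ⟨s', hs', p', hp'⟩
    refine ⟨s * s', mul_mem hs hs', p * p', ?_⟩
    rw [map_mul, map_mul, ← hp, ← hp']; ring
  one_mem' := ⟨1, one_mem _, 1, by simp⟩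
  add_mem' := by
    rintro a b ⟨s, hs, p, hp⟩ ⟨s', hs', p', hp'⟩
    refine ⟨s * s', mul_mem hs hs', p * s' + p' * s, ?_⟩
    rw [map_add, map_mul, map_mul, map_mul, ← hp, ← hp']; ring
  zero_mem' := ⟨1, one_mem _, 0, by simp⟩
  neg_mem' := by
    rintro a ⟨s, hs, p, hp⟩
    exact ⟨s, hs, -p, by rw [map_neg, ← hp]; ring⟩

theorem fracs_mono {S T : Submonoid (PolyTX K m)} (hST : S ≤ T) : fracs S ≤ fracs T :=
  fun _ ⟨s, hs, p, hp⟩ => ⟨s, hST hs, p, hp⟩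

theorem algebraMap_mem_fracs (S : Submonoid (PolyTX K m)) (p : PolyTX K m) :
    algebraMap _ (RatTX K m) p ∈ fracs S := ⟨1, one_mem _, p, by simp⟩

theorem algebraMap_ne_zero_of_ne_zero {p : PolyTX K m} (hp : p ≠ 0) :
    algebraMap _ (RatTX K m) p ≠ 0 :=
  fun h => hp (IsFractionRing.injective (PolyTX K m) (RatTX K m) (by simpa using h))

theorem inv_algebraMap_mem_fracs {S : Submonoid (PolyTX K m)} {s : PolyTX K m} (hs : s ∈ S)
    (h0 : s ≠ 0) : (algebraMap _ (RatTX K m) s)⁻¹ ∈ fracs S :=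
  ⟨s, hs, 1, by rw [map_one, mul_inv_cancel₀ (algebraMap_ne_zero_of_ne_zero h0)]⟩

theorem shiftTX_mem_fracs {S : Submonoid (PolyTX K m)} {v : ShiftVar m}
    (hS : ∀ s ∈ S, polyShift K v s ∈ S) {h : RatTX K m} (hh : h ∈ fracs S) :
    shiftTX K v h ∈ fracs S := by
  obtain ⟨s, hs, p, hp⟩ := hh
  refine ⟨polyShift K v s, hS s hs, polyShift K v p, ?_⟩
  rw [← shiftTX_algebraMap, ← shiftTX_algebraMap, ← map_mul, hp]

theorem polyShift_X (v w : ShiftVar m) : polyShift K v (MvPolynomial.X w) =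
    if w = v then MvPolynomial.X w + MvPolynomial.C 1 else MvPolynomial.X w :=
  polyTranslate_X K v w 1

theorem shiftTX_symm_algebraMap (v : ShiftVar m) (p : PolyTX K m) :
    (shiftTX K v).symm (algebraMap (PolyTX K m) (RatTX K m) p) =
      algebraMap (PolyTX K m) (RatTX K m) ((polyShift K v).symm p) := by
  rw [AlgEquiv.symm_apply_eq, shiftTX_algebraMap, AlgEquiv.apply_symm_apply]

/-- The multiplicative set of the nonzero polynomials in which the variable `v` does not occur. -/
def freeOf (K : Type*) [Field K] {m : ℕ} (v : ShiftVar m) : Submonoid (PolyTX K m) where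
  carrier := {p | p ∈ MvPolynomial.supported K {w | w ≠ v} ∧ p ≠ 0}
  mul_mem' := fun ha hb => ⟨mul_mem ha.1 hb.1, mul_ne_zero ha.2 hb.2⟩
  one_mem' := ⟨one_mem _, one_ne_zero⟩

theorem polyShift_mem_supported {s : Set (ShiftVar m)} (v : ShiftVar m) {p : PolyTX K m}
    (hp : p ∈ MvPolynomial.supported K s) : polyShift K v p ∈ MvPolynomial.supported K s := by
  suffices MvPolynomial.supported K s ≤
      (MvPolynomial.supported K s).comap (polyShift K v).toAlgHom from this hp
  rw [MvPolynomial.supported_eq_adjoin_X, Algebra.adjoin_le_iff]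
  rintro _ ⟨w, hw, rfl⟩
  have h1 : (MvPolynomial.X w : PolyTX K m) ∈ Algebra.adjoin K (MvPolynomial.X '' s) :=
    Algebra.subset_adjoin ⟨w, hw, rfl⟩
  change polyShift K v (MvPolynomial.X w) ∈ Algebra.adjoin K (MvPolynomial.X '' s)
  rw [polyShift_X]
  split_ifs
  · exact add_mem h1 (Subalgebra.algebraMap_mem _ 1)
  · exact h1

theorem polyShift_mem_freeOf (v w : ShiftVar m) {p : PolyTX K m} (hp : p ∈ freeOf K v) :
    polyShift K w p ∈ freeOf K v :=
  ⟨polyShift_mem_supported w hp.1, fun h => hp.2 (by simpa using h)⟩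

theorem polyShift_eq_self_of_mem_supported {v : ShiftVar m} {p : PolyTX K m}
    (hp : p ∈ MvPolynomial.supported K {w | w ≠ v}) : polyShift K v p = p := by
  suffices MvPolynomial.supported K {w | w ≠ v} ≤
      AlgHom.equalizer (polyShift K v).toAlgHom (AlgHom.id K _) from this hp
  rw [MvPolynomial.supported_eq_adjoin_X, Algebra.adjoin_le_iff]
  rintro _ ⟨w, hw, rfl⟩
  change polyShift K v (MvPolynomial.X w) = MvPolynomial.X w
  rw [polyShift_X, if_neg hw]

/-- The elements of `K(w : w ≠ v)` have a denominator that is free of `v`. -/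
theorem adjoin_le_fracs_freeOf (v : ShiftVar m) {h : RatTX K m}
    (hh : h ∈ IntermediateField.adjoin K (varTX K '' {w : ShiftVar m | w ≠ v})) :
    h ∈ fracs (freeOf K v) := by
  have himage : varTX K '' {w : ShiftVar m | w ≠ v} =
      (IsScalarTower.toAlgHom K (PolyTX K m) (RatTX K m)) '' (MvPolynomial.X '' {w | w ≠ v}) := by
    rw [Set.image_image]; rfl
  rw [IntermediateField.mem_adjoin_iff_div, himage, ← AlgHom.map_adjoin] at hh
  obtain ⟨_, ⟨r, hr, rfl⟩, _, ⟨s, hs, rfl⟩, rfl⟩ := hh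
  by_cases h0 : s = 0
  · simp [h0, zero_mem]
  · rw [div_eq_mul_inv]
    exact mul_mem (algebraMap_mem_fracs _ r) (inv_algebraMap_mem_fracs ⟨hs, h0⟩ h0)

end Fracs

/-! ### Orbits of primes and partial fractions -/

section Orbit

variable {K : Type*} [Field K] {m : ℕ}

/-- Every element of the group generated by the shifts is induced by a translation of the
polynomial ring. -/
theorem exists_translate_of_mem {m n : ℕ} {hnm : n ≤ m} {σ : RatTX K m ≃ₐ[K] RatTX K m}
    (hσ : σ ∈ groupTX K hnm) :
    ∃ φ : PolyTX K m ≃ₐ[K] PolyTX K m, (∀ p, σ (algebraMap _ _ p) = algebraMap _ _ (φ p)) ∧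
      ∃ c : ShiftVar m → K, ∀ w, φ (MvPolynomial.X w) = MvPolynomial.X w + MvPolynomial.C (c w) := by
  have hgen : ∀ v : ShiftVar m, ∃ φ : PolyTX K m ≃ₐ[K] PolyTX K m,
      (∀ p, shiftTX K v (algebraMap _ _ p) = algebraMap _ _ (φ p)) ∧ ∃ c : ShiftVar m → K,
        ∀ w, φ (MvPolynomial.X w) = MvPolynomial.X w + MvPolynomial.C (c w) := fun v =>
    ⟨polyShift K v, shiftTX_algebraMap K v, fun w => if w = v then 1 else 0, fun w => by
      rw [polyShift_X]; split_ifs <;> simp_all⟩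
  induction hσ using Subgroup.closure_induction with
  | mem x hx =>
    rcases hx with rfl | ⟨i, rfl⟩
    · exact hgen _
    · exact hgen _
  | one => exact ⟨AlgEquiv.refl, fun p => rfl, 0, fun w => by simp⟩
  | mul x y _ _ hx hy =>
    obtain ⟨φ, h1, c, h2⟩ := hx
    obtain ⟨ψ, h3, c', h4⟩ := hy
    refine ⟨ψ.trans φ, fun p => ?_, fun w => c w + c' w, fun w => ?_⟩
    · rw [AlgEquiv.mul_apply, h3, h1]; rfl
    · have : φ (MvPolynomial.C (c' w)) = MvPolynomial.C (c' w) := φ.commutes _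
      simp [h4, h2, this, add_assoc]
  | inv x _ hx =>
    obtain ⟨φ, h1, c, h2⟩ := hx
    refine ⟨φ.symm, fun p => ?_, fun w => -c w, fun w => ?_⟩
    · change x.symm _ = _
      rw [AlgEquiv.symm_apply_eq, h1, AlgEquiv.apply_symm_apply]
    · have : φ (MvPolynomial.C (-c w)) = MvPolynomial.C (-c w) := φ.commutes _
      rw [AlgEquiv.symm_apply_eq, map_add, h2, this]
      simp

theorem groupX_le_groupTX (K : Type*) [Field K] {m n : ℕ} (hnm : n ≤ m) :
    groupX K hnm ≤ groupTX K hnm :=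
  Subgroup.closure_mono (Set.subset_insert _ _)

/-- The polynomials in the orbit of the polynomial `d` under the group `A`. -/
def polyOrbit (A : Subgroup (RatTX K m ≃ₐ[K] RatTX K m)) (d : PolyTX K m) : Set (PolyTX K m) :=
  {p | ∃ σ ∈ A, algebraMap _ (RatTX K m) p = σ (algebraMap _ (RatTX K m) d)}

theorem irreducible_of_mem_polyOrbit {n : ℕ} {hnm : n ≤ m} {d : PolyTX K m} (hd : Irreducible d)
    {p : PolyTX K m} (hp : p ∈ polyOrbit (groupTX K hnm) d) : Irreducible p := by
  obtain ⟨σ, hσ, hp⟩ := hp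
  obtain ⟨φ, hφ, -⟩ := exists_translate_of_mem hσ
  rw [hφ] at hp
  rw [IsFractionRing.injective _ _ hp]
  exact (MulEquiv.irreducible_iff φ).mpr hd

theorem polyShift_mem_polyOrbit {A : Subgroup (RatTX K m ≃ₐ[K] RatTX K m)} {v : ShiftVar m}
    (hv : shiftTX K v ∈ A) {d p : PolyTX K m} (hp : p ∈ polyOrbit A d) :
    polyShift K v p ∈ polyOrbit A d := by
  obtain ⟨σ, hσ, hp⟩ := hp
  exact ⟨shiftTX K v * σ, mul_mem hv hσ, by
    rw [AlgEquiv.mul_apply, ← hp, shiftTX_algebraMap]⟩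

theorem polyShift_symm_mem_polyOrbit {A : Subgroup (RatTX K m ≃ₐ[K] RatTX K m)} {v : ShiftVar m}
    (hv : shiftTX K v ∈ A) {d p : PolyTX K m} (hp : p ∈ polyOrbit A d) :
    (polyShift K v).symm p ∈ polyOrbit A d := by
  obtain ⟨σ, hσ, hp⟩ := hp
  exact ⟨(shiftTX K v)⁻¹ * σ, mul_mem (inv_mem hv) hσ, by
    rw [AlgEquiv.mul_apply, ← hp]; exact (shiftTX_symm_algebraMap v p).symm⟩

/-- The multiplicative set of the polynomials divisible by no element of a set `P` of primes. -/
def primeTo (P : Set (PolyTX K m)) (hP : ∀ p ∈ P, Irreducible p) : Submonoid (PolyTX K m) where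
  carrier := {s | ∀ p ∈ P, ¬ p ∣ s}
  mul_mem' := fun ha hb p hp h => ((hP p hp).prime.dvd_or_dvd h).elim (ha p hp) (hb p hp)
  one_mem' := fun p hp h => (hP p hp).not_isUnit (isUnit_of_dvd_one h)

variable {P : Set (PolyTX K m)} {hP : ∀ p ∈ P, Irreducible p}

theorem mem_primeTo {s : PolyTX K m} : s ∈ primeTo P hP ↔ ∀ p ∈ P, ¬ p ∣ s := Iff.rfl

/-- A nonzero polynomial is a product of primes in `P` and a part divisible by none of them. Constants
of `K` go to the second factor, since `P` need not be stable under scaling. -/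
theorem exists_mul_of_ne_zero (hP : ∀ p ∈ P, Irreducible p) {b : PolyTX K m} (hb : b ≠ 0) :
    ∃ u ∈ Submonoid.closure P, ∃ w ∈ primeTo P hP, b = u * w := by
  induction b using UniqueFactorizationMonoid.induction_on_prime with
  | h₁ => exact absurd rfl hb
  | h₂ x hx =>
    exact ⟨1, one_mem _, x, fun p hp h => (hP p hp).not_isUnit (isUnit_of_dvd_unit h hx), by simp⟩
  | h₃ a q ha hq ih =>
    obtain ⟨u, hu, w, hw, rfl⟩ := ih ha
    by_cases hqP : q ∈ primeTo P hP
    · exact ⟨u, hu, q * w, mul_mem hqP hw, by ring⟩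
    · rw [mem_primeTo] at hqP
      push Not at hqP
      obtain ⟨p, hp, hpq⟩ := hqP
      obtain ⟨c, rfl⟩ := ((hP p hp).dvd_symm hq.irreducible hpq)
      have hc : IsUnit c := by
        rcases (hP _ hp).isUnit_or_isUnit rfl with h | h
        · exact absurd h hq.not_isUnit
        · exact h
      obtain ⟨c, rfl⟩ := hc
      refine ⟨(q * c) * u, mul_mem (Submonoid.subset_closure hp) hu, ↑c⁻¹ * w,
        mul_mem (fun p hp h => (hP p hp).not_isUnit (isUnit_of_dvd_unit h c⁻¹.isUnit)) hw, ?_⟩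
      calc q * (u * w) = q * (u * w) * (c * ↑c⁻¹) := by rw [Units.mul_inv, mul_one]
        _ = _ := by ring

/-- The Bézout relations for single primes multiply up to products. -/
theorem exists_bezout_freeOf (v : ShiftVar m) {u w : PolyTX K m}
    (hu : u ∈ Submonoid.closure P) (hw : w ∈ primeTo P hP) :
    ∃ α β : PolyTX K m, ∃ r ∈ freeOf K v, α * u + β * w = r := by
  induction hu using Submonoid.closure_induction with
  | mem p hp =>
    obtain ⟨α, β, r, hr, hr0, h⟩ := MvPolynomial.exists_bezout_supported v (hP p hp) (hw p hp)
    exact ⟨α, β, r, ⟨hr, hr0⟩, h⟩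
  | one => exact ⟨1, 0, 1, one_mem _, by simp⟩
  | mul x y _ _ hx hy =>
    obtain ⟨α, β, r, hr, h⟩ := hx
    obtain ⟨α', β', r', hr', h'⟩ := hy
    refine ⟨α * α', α * x * β' + β * α' * y + β * β' * w, r * r', mul_mem hr hr', ?_⟩
    rw [← h, ← h']; ring

/-- Partial fractions with respect to the variable `v`: every rational function is the sum of one
with poles in `P` and one with poles outside `P`, where denominators free of `v` do not count
as poles. -/
theorem exists_add_of_poles (hP : ∀ p ∈ P, Irreducible p) (v : ShiftVar m) (h : RatTX K m) :
    ∃ f ∈ fracs (freeOf K v ⊔ Submonoid.closure P), ∃ g ∈ fracs (freeOf K v ⊔ primeTo P hP),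
      h = f + g := by
  obtain ⟨a, b, hb, rfl⟩ := IsFractionRing.div_surjective (A := PolyTX K m) h
  have hb0 : b ≠ 0 := nonZeroDivisors.ne_zero hb
  obtain ⟨u, hu, w, hw, rfl⟩ := exists_mul_of_ne_zero hP hb0
  obtain ⟨α, β, r, hr, hαβ⟩ := exists_bezout_freeOf v hu hw
  have hr0 := algebraMap_ne_zero_of_ne_zero hr.2
  have hu0 := algebraMap_ne_zero_of_ne_zero (left_ne_zero_of_mul hb0)
  have hw0 := algebraMap_ne_zero_of_ne_zero (right_ne_zero_of_mul hb0)
  refine ⟨algebraMap _ _ (a * β) / algebraMap _ _ (r * u),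
    ⟨r * u, Submonoid.mul_mem_sup hr hu, a * β, ?_⟩,
    algebraMap _ _ (a * α) / algebraMap _ _ (r * w),
    ⟨r * w, Submonoid.mul_mem_sup hr hw, a * α, ?_⟩, ?_⟩
  · rw [map_mul]; field_simp
  · rw [map_mul]; field_simp
  · have := congrArg (algebraMap (PolyTX K m) (RatTX K m)) hαβ
    simp only [map_add, map_mul] at *
    field_simp
    rw [← this]; ring

/-- A function with poles in `P` and no poles in `P` has no poles: its denominator is free of
`v`. -/
theorem mem_fracs_freeOf_of_poles {v : ShiftVar m} {h : RatTX K m}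
    (h1 : h ∈ fracs (freeOf K v ⊔ Submonoid.closure P))
    (h2 : h ∈ fracs (freeOf K v ⊔ primeTo P hP)) : h ∈ fracs (freeOf K v) := by
  obtain ⟨_, hs, p, hp⟩ := h1
  obtain ⟨_, hs', p', hp'⟩ := h2
  obtain ⟨r, hr, u, hu, rfl⟩ := Submonoid.mem_sup.mp hs
  obtain ⟨r', hr', w, hw, rfl⟩ := Submonoid.mem_sup.mp hs'
  obtain ⟨α, β, q, hq, hαβ⟩ := exists_bezout_freeOf v hu hw
  refine ⟨r * r' * q, mul_mem (mul_mem hr hr') hq, r' * α * p + r * β * p', ?_⟩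
  rw [← hαβ]
  simp only [map_add, map_mul, ← hp, ← hp']
  ring

theorem polyShift_mem_sup_closure {v w : ShiftVar m} (hPw : ∀ p ∈ P, polyShift K w p ∈ P)
    {s : PolyTX K m} (hs : s ∈ freeOf K v ⊔ Submonoid.closure P) :
    polyShift K w s ∈ freeOf K v ⊔ Submonoid.closure P := by
  obtain ⟨r, hr, u, hu, rfl⟩ := Submonoid.mem_sup.mp hs
  rw [map_mul]
  refine Submonoid.mul_mem_sup (polyShift_mem_freeOf v w hr) ?_
  suffices Submonoid.closure P ≤
    (Submonoid.closure P).comap (polyShift K w : PolyTX K m →* PolyTX K m) from this hu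
  rw [Submonoid.closure_le]
  exact fun p hp => Submonoid.subset_closure (hPw p hp)

theorem polyShift_mem_sup_primeTo {v w : ShiftVar m} (hPw : ∀ p ∈ P, (polyShift K w).symm p ∈ P)
    {s : PolyTX K m} (hs : s ∈ freeOf K v ⊔ primeTo P hP) :
    polyShift K w s ∈ freeOf K v ⊔ primeTo P hP := by
  obtain ⟨r, hr, u, hu, rfl⟩ := Submonoid.mem_sup.mp hs
  rw [map_mul]
  refine Submonoid.mul_mem_sup (polyShift_mem_freeOf v w hr) fun p hp h => ?_
  apply hu _ (hPw p hp)
  have := map_dvd (polyShift K w).symm h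
  rwa [AlgEquiv.symm_apply_apply] at this

end Orbit

/-! ### Summable functions -/

section Summable

variable {K : Type*} [Field K] {m n : ℕ}

theorem shiftTX_some_fieldT (i : Fin m) (c : FieldT K m) :
    shiftTX K (some i) (c : RatTX K m) = c := by
  have h : FieldT K m ≤ IntermediateField.fixedField (Subgroup.zpowers (shiftTX K (some i))) := by
    rw [IntermediateField.adjoin_le_iff, Set.singleton_subset_iff]
    rintro ⟨τ, hτ⟩
    have : Subgroup.zpowers (shiftTX K (some i)) ≤
        MulAction.stabilizer (RatTX K m ≃ₐ[K] RatTX K m) (varTX K (none : ShiftVar m)) := by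
      rw [Subgroup.zpowers_le]
      exact shiftTX_var_of_ne K _ _ (by simp)
    exact this hτ
  exact h c.2 ⟨_, Subgroup.mem_zpowers _⟩

/-- The summable rational functions, as a `K(t)`-subspace. -/
def summableX (K : Type*) [Field K] {m n : ℕ} (hnm : n ≤ m) :
    Submodule (FieldT K m) (RatTX K m) where
  carrier := {f | IsSummableX hnm f}
  add_mem' := by
    rintro a b ⟨g, rfl⟩ ⟨g', rfl⟩
    refine ⟨g + g', ?_⟩
    rw [← Finset.sum_add_distrib]
    refine Finset.sum_congr rfl fun i _ => ?_
    rw [Pi.add_apply, map_add]; ring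
  zero_mem' := ⟨0, by simp⟩
  smul_mem' := by
    rintro c a ⟨g, rfl⟩
    refine ⟨fun i => c * g i, ?_⟩
    rw [Algebra.smul_def, Finset.mul_sum]
    refine Finset.sum_congr rfl fun i _ => ?_
    rw [map_mul, shiftTX_some_fieldT, mul_sub]; rfl

theorem shiftTX_sub_mem_summableX (hnm : n ≤ m) (i : Fin n) (g : RatTX K m) :
    shiftTX K (some (Fin.castLE hnm i)) g - g ∈ summableX K hnm := by
  classical
  refine ⟨Pi.single i g, ?_⟩
  rw [Finset.sum_eq_single i]
  · simp
  · intro k _ hk; simp [hk]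
  · simp

theorem shiftTX_none_mem_summableX {hnm : n ≤ m} {f : RatTX K m} (hf : f ∈ summableX K hnm) :
    shiftTX K none f ∈ summableX K hnm := by
  obtain ⟨g, rfl⟩ := hf
  refine ⟨fun i => shiftTX K none (g i), ?_⟩
  rw [map_sum]
  refine Finset.sum_congr rfl fun i _ => ?_
  rw [map_sub, ← AlgEquiv.mul_apply, ← AlgEquiv.mul_apply, shiftTX_comm]

/-- Bernoulli polynomials are antidifferences of the powers of a variable. -/
theorem exists_shift_sub_eq_pow [CharZero K] (v : ShiftVar m) (k : ℕ) :
    ∃ g : RatTX K m, shiftTX K v g - g = varTX K v ^ k := by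
  have : CharZero (RatTX K m) :=
    charZero_of_injective_algebraMap (algebraMap K (RatTX K m)).injective
  have h := congrArg (Polynomial.aeval (varTX K v)) (Polynomial.bernoulli_comp_one_add_X (k + 1))
  rw [Polynomial.aeval_comp] at h
  simp only [map_add, map_one, Polynomial.aeval_X, map_nsmul, map_pow, add_tsub_cancel_right] at h
  have h2 : shiftTX K v (Polynomial.aeval (varTX K v) (Polynomial.bernoulli (k + 1))) =
      Polynomial.aeval (1 + varTX K v) (Polynomial.bernoulli (k + 1)) := by
    have := Polynomial.aeval_algHom_apply
      (shiftTX K v : RatTX K m →+* RatTX K m).toRatAlgHom (varTX K v) (Polynomial.bernoulli (k + 1))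
    rw [add_comm 1, ← shiftTX_var_self]
    exact this.symm
  have hk : ((k + 1 : ℕ) : RatTX K m) ≠ 0 := Nat.cast_ne_zero.mpr (Nat.succ_ne_zero k)
  refine ⟨Polynomial.aeval (varTX K v) (Polynomial.bernoulli (k + 1)) / ((k + 1 : ℕ) : RatTX K m), ?_⟩
  rw [map_div₀, h2, map_natCast, h, nsmul_eq_mul]
  field_simp
  ring

/-- Every polynomial in `x_1` with coefficients in `K(t, x_2, …, x_m)` is a difference in `x_1`
alone. -/
theorem fracs_freeOf_le_summableX [CharZero K] [NeZero m] (hn : 1 ≤ n) (hnm : n ≤ m)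
    {h : RatTX K m} (hh : h ∈ fracs (freeOf K (some 0 : ShiftVar m))) : h ∈ summableX K hnm := by
  classical
  obtain ⟨r, hr, p, hp⟩ := hh
  have hr0 := algebraMap_ne_zero_of_ne_zero hr.2
  have hfix : ∀ q ∈ MvPolynomial.supported K {w : ShiftVar m | w ≠ some 0}, ∀ k : ℕ,
      algebraMap _ (RatTX K m) q * varTX K (some 0) ^ k / algebraMap _ (RatTX K m) r ∈
        summableX K hnm := by
    intro q hq k
    obtain ⟨g, hg⟩ := exists_shift_sub_eq_pow (K := K) (some 0 : ShiftVar m) k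
    have := shiftTX_sub_mem_summableX hnm ⟨0, hn⟩
      (algebraMap _ (RatTX K m) q * g / algebraMap _ (RatTX K m) r)
    have h0 : (Fin.castLE hnm ⟨0, hn⟩ : Fin m) = 0 := Fin.ext (by simp)
    rw [h0, map_div₀, map_mul, shiftTX_algebraMap, shiftTX_algebraMap,
      polyShift_eq_self_of_mem_supported hq, polyShift_eq_self_of_mem_supported hr.1,
      ← sub_div, ← mul_sub, hg] at this
    exact this
  obtain rfl : h = algebraMap _ (RatTX K m) p / algebraMap _ (RatTX K m) r := by
    rw [← hp]; field_simp
  clear hp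
  induction p using MvPolynomial.induction_on' with
  | add p q hp hq => rw [map_add, add_div]; exact add_mem hp hq
  | monomial s c =>
    have hs : MvPolynomial.monomial s c =
        MvPolynomial.monomial (s.erase (some 0)) c * MvPolynomial.X (some 0) ^ s (some 0) := by
      rw [MvPolynomial.X_pow_eq_monomial, MvPolynomial.monomial_mul, mul_one,
        Finsupp.erase_add_single]
    rw [hs, map_mul, map_pow]
    refine hfix _ ?_ _
    rw [MvPolynomial.mem_supported]
    by_cases hc : c = 0
    · simp [hc]
    · rw [MvPolynomial.vars_monomial hc]
      intro w hw
      simp only [Finsupp.support_erase, Finset.coe_erase] at hw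
      exact hw.2

/-- If a sum `f + g` is summable, `f` has its poles in a set `P` of primes that is stable under the
shifts, and `g` has its poles outside `P`, then `f` is summable. -/
theorem mem_summableX_of_add_mem [CharZero K] [NeZero m] (hn : 1 ≤ n) (hnm : n ≤ m)
    {P : Set (PolyTX K m)} {hP : ∀ p ∈ P, Irreducible p}
    (hPs : ∀ i : Fin n, ∀ p ∈ P, polyShift K (some (Fin.castLE hnm i)) p ∈ P)
    (hPs' : ∀ i : Fin n, ∀ p ∈ P, (polyShift K (some (Fin.castLE hnm i))).symm p ∈ P)
    {f g : RatTX K m}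
    (hf : f ∈ fracs (freeOf K (some 0 : ShiftVar m) ⊔ Submonoid.closure P))
    (hg : g ∈ fracs (freeOf K (some 0 : ShiftVar m) ⊔ primeTo P hP))
    (hfg : f + g ∈ summableX K hnm) : f ∈ summableX K hnm := by
  obtain ⟨h, hh⟩ := hfg
  choose u hu w hw huw using fun i => exists_add_of_poles hP (some 0) (h i)
  set A := ∑ i, (shiftTX K (some (Fin.castLE hnm i)) (u i) - u i) with hA
  set B := ∑ i, (shiftTX K (some (Fin.castLE hnm i)) (w i) - w i) with hB
  have hAB : f + g = A + B := by
    rw [hh, hA, hB, ← Finset.sum_add_distrib]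
    refine Finset.sum_congr rfl fun i _ => ?_
    rw [huw, map_add]; ring
  have hAu : A ∈ fracs (freeOf K (some 0 : ShiftVar m) ⊔ Submonoid.closure P) :=
    sum_mem fun i _ => sub_mem
      (shiftTX_mem_fracs (fun s hs => polyShift_mem_sup_closure (hPs i) hs) (hu i)) (hu i)
  have hBw : B ∈ fracs (freeOf K (some 0 : ShiftVar m) ⊔ primeTo P hP) :=
    sum_mem fun i _ => sub_mem
      (shiftTX_mem_fracs (fun s hs => polyShift_mem_sup_primeTo (hPs' i) hs) (hw i)) (hw i)
  have hD : f - A ∈ fracs (freeOf K (some 0 : ShiftVar m)) := by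
    apply mem_fracs_freeOf_of_poles (sub_mem hf hAu) (hP := hP)
    rw [show f - A = B - g by linear_combination hAB]
    exact sub_mem hBw hg
  have hAs : A ∈ summableX K hnm := sum_mem fun i _ => shiftTX_sub_mem_summableX hnm i _
  rw [← sub_add_cancel f A]
  exact add_mem (fracs_freeOf_le_summableX hn hnm hD) hAs

end Summable

/-! ### Telescopers and finite dimension -/

section Telescoper

variable {K : Type*} [Field K] {m n : ℕ}

/-- Telescopers as finitely supported families of coefficients, without the ring of operators. -/
theorem hasTelescoper_iff (hnm : n ≤ m) (f : RatTX K m) :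
    HasTelescoper hnm f ↔ ∃ e : ℕ →₀ FieldT K m, e ≠ 0 ∧
      e.sum (fun i c => c • (shiftTX K none ^ i) f) ∈ summableX K hnm := by
  constructor
  · rintro ⟨L, hL, h⟩
    refine ⟨Finsupp.equivMapDomain Multiplicative.toAdd (SkewMonoidAlgebra.coeff L), fun h0 => hL ?_, ?_⟩
    · rw [← SkewMonoidAlgebra.coeff_eq_zero]
      ext x : 1
      simpa using DFunLike.congr_fun h0 (Multiplicative.toAdd x)
    · rw [Finsupp.sum_equivMapDomain]
      exact h
  · rintro ⟨e, he, h⟩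
    refine ⟨⟨Finsupp.equivMapDomain Multiplicative.ofAdd e⟩, fun h0 => he ?_, ?_⟩
    · rw [SkewMonoidAlgebra.ofCoeff_eq_zero] at h0
      ext x : 1
      simpa using DFunLike.congr_fun h0 (Multiplicative.ofAdd x)
    · change Finsupp.sum (Finsupp.equivMapDomain Multiplicative.ofAdd e) _ ∈ summableX K hnm
      rw [Finsupp.sum_equivMapDomain]
      exact h

/-- The shifts `σ_t^k(f)` span a finite-dimensional `K(t)`-space modulo the summable functions. -/
def ShiftFinite (hnm : n ≤ m) (f : RatTX K m) : Prop :=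
  ∃ W : Submodule (FieldT K m) (RatTX K m), W.FG ∧
    ∀ k : ℕ, (shiftTX K none ^ k) f ∈ summableX K hnm ⊔ W

theorem shiftFinite_sum {hnm : n ≤ m} {ι : Type*} (s : Finset ι) {f : ι → RatTX K m}
    (hf : ∀ i ∈ s, ShiftFinite hnm (f i)) : ShiftFinite hnm (∑ i ∈ s, f i) := by
  classical
  induction s using Finset.induction_on with
  | empty => exact ⟨⊥, Submodule.fg_bot, fun k => by simp⟩
  | insert a s has ih =>
    obtain ⟨W, hW, h⟩ := hf a (Finset.mem_insert_self a s)
    obtain ⟨W', hW', h'⟩ := ih fun i hi => hf i (Finset.mem_insert_of_mem hi)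
    refine ⟨W ⊔ W', hW.sup hW', fun k => ?_⟩
    rw [Finset.sum_insert has, map_add]
    exact add_mem ((sup_le_sup_left le_sup_left _ : summableX K hnm ⊔ W ≤ summableX K hnm ⊔ (W ⊔ W')) (h k))
      ((sup_le_sup_left le_sup_right _ : summableX K hnm ⊔ W' ≤ summableX K hnm ⊔ (W ⊔ W')) (h' k))

/-- A telescoper expresses some `σ_t^N(f)` through lower shifts modulo the summable functions, so
the span of these lower shifts is stable under `σ_t`. -/
theorem HasTelescoper.shiftFinite {hnm : n ≤ m} {f : RatTX K m} (hf : HasTelescoper hnm f) :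
    ShiftFinite hnm f := by
  obtain ⟨e, he, h⟩ := (hasTelescoper_iff hnm f).mp hf
  have hne : e.support.Nonempty := Finsupp.support_nonempty_iff.mpr he
  set N := e.support.max' hne with hN
  have hNmem : N ∈ e.support := e.support.max'_mem hne
  set W := Submodule.span (FieldT K m) ((fun i : ℕ => (shiftTX K none ^ i) f) '' Set.Iio N) with hW
  have hlt : ∀ i < N, (shiftTX K none ^ i) f ∈ summableX K hnm ⊔ W := fun i hi =>
    Submodule.mem_sup_right (Submodule.subset_span ⟨i, hi, rfl⟩)
  have hNV : (shiftTX K none ^ N) f ∈ summableX K hnm ⊔ W := by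
    rw [Finsupp.sum, ← Finset.add_sum_erase _ _ hNmem] at h
    have hrest : ∑ i ∈ e.support.erase N, e i • (shiftTX K none ^ i) f ∈ summableX K hnm ⊔ W :=
      sum_mem fun i hi => Submodule.smul_mem _ _ (hlt i (lt_of_le_of_ne
        (e.support.le_max' i (Finset.mem_of_mem_erase hi)) (Finset.ne_of_mem_erase hi)))
    rw [← Submodule.smul_mem_iff _ (Finsupp.mem_support_iff.mp hNmem)]
    exact (add_mem_cancel_right hrest).mp (Submodule.mem_sup_left h)
  have hstep : ∀ x ∈ summableX K hnm ⊔ W, shiftTX K none x ∈ summableX K hnm ⊔ W := by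
    intro x hx
    obtain ⟨y, hy, z, hz, rfl⟩ := Submodule.mem_sup.mp hx
    rw [map_add]
    refine add_mem (Submodule.mem_sup_left (shiftTX_none_mem_summableX hy)) ?_
    clear hx
    induction hz using Submodule.span_induction with
    | mem x hx =>
      obtain ⟨i, hi, rfl⟩ := hx
      have : shiftTX K none ((shiftTX K none ^ i) f) = (shiftTX K none ^ (i + 1)) f := by
        rw [pow_succ', AlgEquiv.mul_apply]
      dsimp only
      rw [this]
      rcases Nat.lt_or_ge (i + 1) N with h1 | h1
      · exact hlt _ h1
      · rwa [show i + 1 = N from le_antisymm hi h1]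
    | zero => simp
    | add x y _ _ hx hy => rw [map_add]; exact add_mem hx hy
    | smul c x _ hx =>
      have : shiftTX K none (c • x) = shiftT K m c • shiftTX K none x := by
        rw [Algebra.smul_def, Algebra.smul_def, map_mul]; rfl
      rw [this]
      exact Submodule.smul_mem _ _ hx
  refine ⟨W, Submodule.fg_span ((Set.finite_Iio N).image _), fun k => ?_⟩
  induction k with
  | zero =>
    rcases Nat.eq_zero_or_pos N with h0 | h0
    · rwa [h0] at hNV
    · exact hlt 0 h0
  | succ k ih => rw [pow_succ', AlgEquiv.mul_apply]; exact hstep _ ih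

/-- If the shifts of `f` span a finite-dimensional space modulo the summable functions, any
infinite family of them is linearly dependent modulo the summable functions. -/
theorem ShiftFinite.exists_relation {hnm : n ≤ m} {f : RatTX K m} (hf : ShiftFinite hnm f)
    (a : ℕ → ℕ) : ∃ e : ℕ →₀ FieldT K m, e ≠ 0 ∧
      e.sum (fun i c => c • (shiftTX K none ^ a i) f) ∈ summableX K hnm := by
  obtain ⟨W, hW, h⟩ := hf
  by_contra! hcon
  have hfin : Module.Finite (FieldT K m) (W.map (summableX K hnm).mkQ) :=
    Module.Finite.iff_fg.mpr (hW.map _)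
  have hmem : ∀ i, (summableX K hnm).mkQ ((shiftTX K none ^ a i) f) ∈
      W.map (summableX K hnm).mkQ := by
    intro i
    obtain ⟨y, hy, z, hz, hyz⟩ := Submodule.mem_sup.mp (h (a i))
    refine ⟨z, hz, ?_⟩
    have hy0 : (summableX K hnm).mkQ y = 0 := (Submodule.Quotient.mk_eq_zero _).mpr hy
    rw [← hyz, map_add, hy0, zero_add]
  have hLI : LinearIndependent (FieldT K m)
      (fun i => (⟨_, hmem i⟩ : W.map (summableX K hnm).mkQ)) := by
    apply LinearIndependent.of_comp (Submodule.subtype _)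
    rw [linearIndependent_iff]
    intro l hl
    by_contra hl0
    apply hcon l hl0
    rw [← Submodule.ker_mkQ (summableX K hnm), LinearMap.mem_ker, ← hl,
      Finsupp.linearCombination_apply, Finsupp.sum, Finsupp.sum, map_sum]
    exact Finset.sum_congr rfl fun i _ => by rw [map_smul]; rfl
  exact (hLI.finite : Finite ℕ).false

/-- A nontrivial relation among the shifts with exponents `a 0, a 1, …` is a telescoper. -/
theorem hasTelescoper_of_relation {hnm : n ≤ m} {f : RatTX K m} {a : ℕ → ℕ}
    (ha : Function.Injective a) {e : ℕ →₀ FieldT K m} (he : e ≠ 0)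
    (h : e.sum (fun i c => c • (shiftTX K none ^ a i) f) ∈ summableX K hnm) :
    HasTelescoper hnm f := by
  refine (hasTelescoper_iff hnm f).mpr ⟨e.mapDomain a, fun h0 => he ?_, ?_⟩
  · exact Finsupp.mapDomain_injective ha (by simpa using h0)
  · rwa [Finsupp.sum_mapDomain_index (by simp) (by intros; rw [add_smul])]

end Telescoper

/-! ### The isotropy groups -/

section Isotropy

variable {K : Type*} [Field K] {m n : ℕ}

theorem apply_comm_of_mem_groupTX {hnm : n ≤ m} {σ τ : RatTX K m ≃ₐ[K] RatTX K m}
    (hσ : σ ∈ groupTX K hnm) (hτ : τ ∈ groupTX K hnm) (x : RatTX K m) :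
    σ (τ x) = τ (σ x) := by
  rw [← AlgEquiv.mul_apply, ← AlgEquiv.mul_apply, setLike_mul_comm hσ hτ]

theorem shiftTX_none_mem_groupTX (K : Type*) [Field K] {m n : ℕ} (hnm : n ≤ m) :
    shiftTX K none ∈ groupTX K hnm :=
  Subgroup.subset_closure (Set.mem_insert _ _)

theorem exists_eq_zpow_mul_of_mem_groupTX {hnm : n ≤ m} {σ : RatTX K m ≃ₐ[K] RatTX K m}
    (hσ : σ ∈ groupTX K hnm) : ∃ z : ℤ, ∃ τ ∈ groupX K hnm, σ = shiftTX K none ^ z * τ := by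
  have hcomm : ∀ z : ℤ, ∀ τ ∈ groupX K hnm,
      τ * shiftTX K none ^ z = shiftTX K none ^ z * τ := fun z τ hτ =>
    setLike_mul_comm (groupX_le_groupTX K hnm hτ) (zpow_mem (shiftTX_none_mem_groupTX K hnm) z)
  induction hσ using Subgroup.closure_induction with
  | mem x hx =>
    rcases hx with rfl | hx
    · exact ⟨1, 1, one_mem _, by simp⟩
    · exact ⟨0, x, Subgroup.subset_closure hx, by simp⟩
  | one => exact ⟨0, 1, one_mem _, by simp⟩
  | mul x y _ _ hx hy =>
    obtain ⟨z, τ, hτ, rfl⟩ := hx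
    obtain ⟨z', τ', hτ', rfl⟩ := hy
    refine ⟨z + z', τ * τ', mul_mem hτ hτ', ?_⟩
    rw [zpow_add, mul_assoc, ← mul_assoc τ, hcomm z' τ hτ]
    simp only [mul_assoc]
  | inv x _ hx =>
    obtain ⟨z, τ, hτ, rfl⟩ := hx
    refine ⟨-z, τ⁻¹, inv_mem hτ, ?_⟩
    rw [mul_inv_rev, ← zpow_neg, hcomm _ _ (inv_mem hτ)]

open scoped IsMulCommutative in
theorem quotientRank_eq_zero_of_le {Γ : Type*} [Group Γ] {A B : Subgroup Γ} [IsMulCommutative A]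
    (h : A ≤ B) : quotientRank A B = 0 := by
  have : Subsingleton (A ⧸ B.subgroupOf A) := by
    rw [Subgroup.subgroupOf_eq_top.mpr h]; exact QuotientGroup.subsingleton_quotient_top
  have : Subsingleton (Additive (A ⧸ B.subgroupOf A)) := this
  exact Module.finrank_zero_of_subsingleton

/-- If no positive power of `σ_t` moves `x` inside its `G`-orbit, then `G_{t,x} = G_x`, and the rank
is `0`. -/
theorem exists_shift_pow_eq_of_isotropyRank_ne_zero {hnm : n ≤ m} {x : RatTX K m}
    (h : isotropyRank hnm x ≠ 0) :
    ∃ k : ℕ, 0 < k ∧ ∃ τ ∈ groupX K hnm, (shiftTX K none ^ k) x = τ x := by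
  by_contra! hcon
  apply h
  have hle : isotropy (groupTX K hnm) x ≤ isotropy (groupX K hnm) x := by
    rintro σ ⟨hσ, hσx⟩
    refine ⟨?_, hσx⟩
    have hσx' : σ x = x := hσx
    obtain ⟨z, τ, hτ, rfl⟩ := exists_eq_zpow_mul_of_mem_groupTX hσ
    rw [AlgEquiv.mul_apply] at hσx'
    rcases lt_trichotomy z 0 with hz | rfl | hz
    · obtain ⟨k, rfl⟩ : ∃ k : ℕ, z = -k := ⟨z.natAbs, by omega⟩
      refine absurd ?_ (hcon k (by omega) τ hτ)
      rw [zpow_neg, zpow_natCast] at hσx'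
      conv_lhs => rw [← hσx']
      rw [← AlgEquiv.mul_apply, mul_inv_cancel, AlgEquiv.one_apply]
    · simpa using hτ
    · obtain ⟨k, rfl⟩ : ∃ k : ℕ, z = k := ⟨z.natAbs, by omega⟩
      refine absurd ?_ (hcon k (by omega) τ⁻¹ (inv_mem hτ))
      rw [zpow_natCast, apply_comm_of_mem_groupTX
        (pow_mem (shiftTX_none_mem_groupTX K hnm) k) (groupX_le_groupTX K hnm hτ)] at hσx'
      conv_rhs => rw [← hσx']
      rw [← AlgEquiv.mul_apply, inv_mul_cancel, AlgEquiv.one_apply]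
  exact quotientRank_eq_zero_of_le hle

/-- Translates of an irreducible polynomial that divide one another are equal: they differ by a
constant factor, and a translation does not rescale. -/
theorem eq_of_dvd_of_mem_polyOrbit {hnm : n ≤ m} {d p q : PolyTX K m} (hd : Irreducible d)
    (hp : p ∈ polyOrbit (groupTX K hnm) d) (hq : q ∈ polyOrbit (groupTX K hnm) d)
    (hpq : p ∣ q) : p = q := by
  obtain ⟨u, rfl⟩ := (irreducible_of_mem_polyOrbit hd hp).associated_of_dvd
    (irreducible_of_mem_polyOrbit hd hq) hpq
  obtain ⟨c, -, hc⟩ := MvPolynomial.isUnit_iff_eq_C_of_isReduced.mp u.isUnit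
  obtain ⟨ρ, hρ, hp⟩ := hp
  obtain ⟨σ, hσ, hq⟩ := hq
  obtain ⟨φ, hφ, v, hv⟩ := exists_translate_of_mem (mul_mem (inv_mem hρ) hσ)
  have h1 : φ d = MvPolynomial.C c * d := by
    apply IsFractionRing.injective (PolyTX K m) (RatTX K m)
    rw [← hφ, AlgEquiv.mul_apply, ← hq, map_mul, hp, map_mul, ← AlgEquiv.mul_apply,
      inv_mul_cancel, AlgEquiv.one_apply, hc, mul_comm, map_mul]
    congr 1
    exact (ρ⁻¹).commutes c
  have h2 : c = 1 := MvPolynomial.eq_one_of_translate_eq_C_mul φ.toAlgHom v hv hd.ne_zero h1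
  rw [hc, h2, MvPolynomial.C_1, mul_one]

theorem shiftEquivalent_of_apply_eq {A : Subgroup (RatTX K m ≃ₐ[K] RatTX K m)} {p q : RatTX K m}
    {σ τ : RatTX K m ≃ₐ[K] RatTX K m} (hσ : σ ∈ A) (hτ : τ ∈ A) (h : σ p = τ q) :
    ShiftEquivalent A p q := by
  have aux : ∀ {p q : RatTX K m} {σ τ : RatTX K m ≃ₐ[K] RatTX K m}, σ ∈ A → τ ∈ A →
      σ p = τ q → shiftOrbit A p ⊆ shiftOrbit A q := by
    rintro p q σ τ hσ hτ h _ ⟨ρ, hρ, rfl⟩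
    refine ⟨ρ * (σ⁻¹ * τ), mul_mem hρ (mul_mem (inv_mem hσ) hτ), ?_⟩
    rw [AlgEquiv.mul_apply, AlgEquiv.mul_apply, ← h, ← AlgEquiv.mul_apply σ⁻¹, inv_mul_cancel,
      AlgEquiv.one_apply]
  exact Set.Subset.antisymm (aux hσ hτ h) (aux hτ hσ h.symm)

theorem IsPolyX1DegLT.mem_fracs [NeZero m] {a : RatTX K m} {d : PolyTX K m}
    (ha : IsPolyX1DegLT a d) : a ∈ fracs (freeOf K (some 0 : ShiftVar m)) := by
  obtain ⟨p, rfl, -⟩ := ha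
  rw [Polynomial.aeval_eq_sum_range]
  refine sum_mem fun i _ => ?_
  rw [Algebra.smul_def]
  exact mul_mem (adjoin_le_fracs_freeOf _ (p.coeff i).2)
    (pow_mem (algebraMap_mem_fracs _ (MvPolynomial.X (some 0))) i)

theorem shiftTX_pow_mem_fracs_freeOf (v w : ShiftVar m) (k : ℕ) {h : RatTX K m}
    (hh : h ∈ fracs (freeOf K v)) : (shiftTX K w ^ k) h ∈ fracs (freeOf K v) := by
  induction k with
  | zero => exact hh
  | succ k ih =>
    rw [pow_succ', AlgEquiv.mul_apply]
    exact shiftTX_mem_fracs (fun s hs => polyShift_mem_freeOf v w hs) ih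

theorem fieldT_mem_fracs [NeZero m] (c : FieldT K m) :
    (c : RatTX K m) ∈ fracs (freeOf K (some 0 : ShiftVar m)) := by
  apply adjoin_le_fracs_freeOf
  refine IntermediateField.adjoin.mono K _ _ ?_ c.2
  rintro _ rfl
  exact ⟨none, by simp, rfl⟩

theorem shift_pow_apply_of_eq {hnm : n ≤ m} {x : RatTX K m} {k : ℕ}
    {τ : RatTX K m ≃ₐ[K] RatTX K m} (hτ : τ ∈ groupX K hnm)
    (h : (shiftTX K none ^ k) x = τ x) (i l : ℕ) :
    (shiftTX K none ^ (k * l)) ((shiftTX K none ^ i) x) = (τ ^ l) ((shiftTX K none ^ i) x) := by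
  have ht := shiftTX_none_mem_groupTX K hnm
  have hτ' := groupX_le_groupTX K hnm hτ
  induction l with
  | zero => simp
  | succ l ih =>
    rw [mul_add, mul_one, add_comm, pow_add, AlgEquiv.mul_apply, ih,
      apply_comm_of_mem_groupTX (pow_mem ht k) (pow_mem hτ' l),
      apply_comm_of_mem_groupTX (pow_mem ht k) (pow_mem ht i), h,
      ← apply_comm_of_mem_groupTX hτ' (pow_mem ht i), pow_succ, AlgEquiv.mul_apply]

theorem algebraMap_polyShift_iterate (v : ShiftVar m) (k : ℕ) (p : PolyTX K m) :
    algebraMap _ (RatTX K m) ((polyShift K v)^[k] p) =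
      (shiftTX K v ^ k) (algebraMap _ (RatTX K m) p) := by
  induction k with
  | zero => rfl
  | succ k ih =>
    rw [Function.iterate_succ_apply', ← shiftTX_algebraMap, ih, pow_succ', AlgEquiv.mul_apply]

end Isotropy

end

theorem mainTheorem6 {K : Type*} [Field K] [CharZero K] {m n : ℕ} [NeZero m]
    (hn : 1 ≤ n) (hnm : n ≤ m) (I j : ℕ) (hj : 1 ≤ j)
    (d : PolyTX K m) (hd : Irreducible d)
    (a : Fin (I + 1) → RatTX K m) (ha : ∀ i, IsPolyX1DegLT (a i) d)
    (horb : ∀ i i' : Fin (I + 1), i ≠ i' →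
      ¬ ShiftEquivalent (groupX K hnm)
        ((shiftTX K none ^ (i : ℕ)) (algebraMap (PolyTX K m) (RatTX K m) d))
        ((shiftTX K none ^ (i' : ℕ)) (algebraMap (PolyTX K m) (RatTX K m) d)))
    (hrank : isotropyRank hnm (algebraMap (PolyTX K m) (RatTX K m) d) = 1)
    (f : RatTX K m)
    (hf : f = ∑ i : Fin (I + 1),
      a i / (shiftTX K none ^ (i : ℕ)) (algebraMap (PolyTX K m) (RatTX K m) d) ^ j) :
    HasTelescoper hnm f ↔
      ∀ i : Fin (I + 1), HasTelescoper hnm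
        (a i / (shiftTX K none ^ (i : ℕ)) (algebraMap (PolyTX K m) (RatTX K m) d) ^ j) := by
  classical
  constructor
  · intro htel i₀
    obtain ⟨k, hk, τ, hτ, hkτ⟩ := exists_shift_pow_eq_of_isotropyRank_ne_zero
      (hnm := hnm) (x := algebraMap (PolyTX K m) (RatTX K m) d) (by omega)
    obtain ⟨e, he, hrel⟩ := htel.shiftFinite.exists_relation (k * ·)
    refine hasTelescoper_of_relation (a := (k * ·)) (mul_right_injective₀ hk.ne') he ?_
    -- The relation sorts into the summands of `f`; the one with index `i₀` has its poles in `P`.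
    set P := polyOrbit (groupX K hnm) ((polyShift K none)^[(i₀ : ℕ)] d)
    have ht := shiftTX_none_mem_groupTX K hnm
    have hPsub : P ⊆ polyOrbit (groupTX K hnm) d := by
      rintro p ⟨σ, hσ, hp⟩
      refine ⟨σ * shiftTX K none ^ (i₀ : ℕ),
        mul_mem (groupX_le_groupTX K hnm hσ) (pow_mem ht _), ?_⟩
      rw [hp, algebraMap_polyShift_iterate, AlgEquiv.mul_apply]
    have hP : ∀ p ∈ P, Irreducible p := fun p hp => irreducible_of_mem_polyOrbit hd (hPsub hp)
    have hgen : ∀ i : Fin n, shiftTX K (some (Fin.castLE hnm i)) ∈ groupX K hnm :=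
      fun i => Subgroup.subset_closure ⟨i, rfl⟩
    have hden : ∀ i l : ℕ, algebraMap _ (RatTX K m) ((polyShift K none)^[k * l + i] d) =
        (τ ^ l) ((shiftTX K none ^ i) (algebraMap _ (RatTX K m) d)) := fun i l => by
      rw [algebraMap_polyShift_iterate, pow_add, AlgEquiv.mul_apply,
        shift_pow_apply_of_eq hτ hkτ]
    have hden_mem : ∀ N : ℕ, (polyShift K none)^[N] d ∈ polyOrbit (groupTX K hnm) d :=
      fun N => ⟨_, pow_mem ht N, algebraMap_polyShift_iterate _ _ _⟩
    -- All denominators of the `i`-th summand of the relation are `j`-th powers of the translates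
    -- `σ_t^{kl + i}(d)`.
    have hterm : ∀ (S : Submonoid (PolyTX K m)) (i : Fin (I + 1)),
        (∀ l : ℕ, (polyShift K none)^[k * l + i] d ∈ S) →
        e.sum (fun l c => c • (shiftTX K none ^ (k * l)) (a i / (shiftTX K none ^ (i : ℕ))
          (algebraMap (PolyTX K m) (RatTX K m) d) ^ j)) ∈
            fracs (freeOf K (some 0 : ShiftVar m) ⊔ S) := by
      intro S i hS
      refine sum_mem fun l _ => ?_
      have hle : fracs (freeOf K (some 0 : ShiftVar m)) ≤ fracs (freeOf K (some 0) ⊔ S) :=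
        fracs_mono le_sup_left
      dsimp only
      rw [Algebra.smul_def, map_div₀, map_pow, div_eq_mul_inv, ← inv_pow]
      refine mul_mem (hle (fieldT_mem_fracs _)) (mul_mem
        (hle (shiftTX_pow_mem_fracs_freeOf _ _ _ (ha i).mem_fracs)) (pow_mem ?_ j))
      rw [← AlgEquiv.mul_apply, ← pow_add, ← algebraMap_polyShift_iterate]
      exact inv_algebraMap_mem_fracs (Submonoid.mem_sup_right (hS l))
        (irreducible_of_mem_polyOrbit hd (hden_mem _)).ne_zero
    refine mem_summableX_of_add_mem hn hnm (hP := hP)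
      (fun i p hp => polyShift_mem_polyOrbit (hgen i) hp)
      (fun i p hp => polyShift_symm_mem_polyOrbit (hgen i) hp)
      (hterm (Submonoid.closure P) i₀ fun l => Submonoid.subset_closure ?_)
      (sum_mem (t := Finset.univ.erase i₀) fun i hi => hterm (primeTo P hP) i fun l p hp hdvd => ?_)
      ?_
    · exact ⟨τ ^ l, pow_mem hτ l, by rw [hden, algebraMap_polyShift_iterate]⟩
    -- A common prime of two different orbits would make them equal.
    · have hpq := eq_of_dvd_of_mem_polyOrbit hd (hPsub hp) (hden_mem _) hdvd
      obtain ⟨ρ, hρ, hp⟩ := hp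
      rw [hpq, hden, algebraMap_polyShift_iterate] at hp
      exact horb i i₀ (Finset.ne_of_mem_erase hi)
        (shiftEquivalent_of_apply_eq (pow_mem hτ l) hρ hp)
    · rw [Finset.add_sum_erase Finset.univ (fun i : Fin (I + 1) => e.sum fun l c =>
        c • (shiftTX K none ^ (k * l)) (a i / (shiftTX K none ^ (i : ℕ))
          (algebraMap (PolyTX K m) (RatTX K m) d) ^ j)) (Finset.mem_univ i₀),
        ← Finsupp.sum_finsetSum_comm]
      convert hrel using 3
      funext c
      rw [hf, map_sum, Finset.smul_sum]
  · intro h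
    rw [hf]
    obtain ⟨e, he, hrel⟩ :=
      (shiftFinite_sum Finset.univ fun i _ => (h i).shiftFinite).exists_relation id
    exact hasTelescoper_of_relation Function.injective_id he hrel
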